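/- Let $n\ge 2$, $k=n-1$, and let $R(T)=\mathbb{Z}[e^{\pm a_1},\ldots,e^{\pm a_n}]/(e^{a_1+\cdots+a_n}-1)$, with indices of $a_i$ read modulo $n$ (so $a_0=a_n$), and $b_i=1-e^{-a_i}$. Put $\alpha_i=a_i-a_{i+1}$ for $i\in\mathbb{Z}/n\mathbb{Z}$. On formal power series in $y=(y_1,y_2,\ldots)$ with coefficients in $R(T)$, let $s_i$ ($1\le i\le n-1$) exchange $a_i$ and $a_{i+1}$ in the coefficients, and let $s_0(f)=\frac{\Omega(b_1|y)}{\Omega(b_n|y)}\,s_\theta(f)$, where $s_\theta$ exchanges $a_1$ and $a_n$ in the coefficients and $\Omega(c|y)=\prod_{j\ge1}(1-c\,y_j)^{-1}$. Let $T_i=(1-e^{\alpha_i})^{-1}(s_i-1)$ and $D_i=T_i+1$. For a $k$-bounded partition $\lambda$ (that is, $\lambda_1\le k$), let $x_\lambda=s_{i_1}\cdots s_{i_l}$ be the corresponding affine Grassmannian element; the reduced word $i_1,\ldots,i_l$ lists the $n$-residues $j-i \bmod n$ of the boxes $(i,j)$ of $\lambda$, each row read from right to left, starting with the bottom row. The $K$-theoretic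 double $k$-Schur function and its closed version are $$g^{(k)}_\lambda(y|b)=T_{i_1}\cdots T_{i_l}(1),\qquad \tilde g^{(k)}_\lambda(y|b)=D_{i_1}\cdots D_{i_l}(1).$$ Let $\sigma$ be the $R(T)$-linear substitution $f(y_1,y_2,\ldots)\mapsto f(1,y_1,y_2,\ldots)$, where the sums over powers of the variable set equal to $1$ are taken in the $(b_1,\ldots,b_n)$-adic topology of $R(T)$ (for example $\sigma(\Omega(b_i|y))=e^{a_i}\Omega(b_i|y)$). (i) Let $\lambda$ be $k$-small, i.e. $k$-bounded with $\lambda_1+\ell(\lambda)\le n$, where $\ell(\lambda)$ is the number of nonzero parts. Then $\sigma(g^{(k)}_\lambda(y|b))$ is defined and $$\sigma(g^{(k)}_\lambda(y|b))=\Bigl(\prod_{x\in\mathrm{diag}(\lambda)}e^{a_{r(x)+1}-a_{b(x)}}\Bigr)\,\tilde g^{(k)}_\lambda(y|b),$$ where $\mathrm{diag}(\lambda)$ is the set of boxes $(i,i)$ of $\lambda$, and $r(x)$ (resp. $b(x)$) is the $n$-residue of the last box of $\lambda$ in the row (resp. column) of $x$. (ii) The assumption of $k$-smallness cannot be dropped: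 for $n=3$ the $2$-bounded partition $(2,1)$ is not $2$-small, and $$\sigma(g^{(2)}_{(2,1)}(y|b))=\tilde g^{(2)}_{(2)}(y|b)+e^{a_3-a_2}\,\tilde g^{(2)}_{(2,1)}(y|b),$$ which is not of the form $c\,\tilde g^{(2)}_{(2,1)}(y|b)$ with $c\in R(T)$. -/

import Mathlib

namespace DoubleKSchur

/-! ### The representation ring `R(T)` of the maximal torus of `SL_n` -/

/-- The character lattice `ℤⁿ / ℤ(1,…,1)` of the maximal torus of `SL_n`.  The coordinates are
indexed by `ZMod n`, with the index `n` identified with `0`. -/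
abbrev CharLattice (n : ℕ) : Type :=
  (ZMod n → ℤ) ⧸ AddSubgroup.zmultiples (fun _ => 1 : ZMod n → ℤ)

/-- The character `a_i`, so that `a_1 + ⋯ + a_n = 0` and `a_n = a_0`. -/
def a (n : ℕ) (i : ZMod n) : CharLattice n :=
  QuotientAddGroup.mk (Pi.single i 1)

/-- `R(T) = ℤ[e^{± a_1}, …, e^{± a_n}] / (e^{a_1 + ⋯ + a_n} - 1)`, as the group ring of the
character lattice. -/
abbrev RT (n : ℕ) : Type := AddMonoidAlgebra ℤ (CharLattice n)

/-- The element `e^v` of `R(T)`. -/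
noncomputable def ex {n : ℕ} (v : CharLattice n) : RT n := AddMonoidAlgebra.single v 1

/-- The equivariant parameter `b_i = 1 - e^{-a_i}`. -/
noncomputable def b (n : ℕ) (i : ZMod n) : RT n := 1 - ex (-a n i)

/-- The simple root `α_i = a_i - a_{i+1}`.  For `i = 0` this is the level zero affine root
`α_0 = -θ = a_n - a_1`. -/
def simpleRoot (n : ℕ) (i : ZMod n) : CharLattice n := a n i - a n (i + 1)

/-- The reflection exchanging `a_i` and `a_{i+1}` on characters; for `i = 0` this is `s_θ`,
exchanging `a_1` and `a_n`. -/
def reflChar (n : ℕ) (i : ZMod n) : CharLattice n →+ CharLattice n :=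
  QuotientAddGroup.map _ _
    (AddMonoidHom.mk' (fun v : ZMod n → ℤ => fun j => v (Equiv.swap i (i + 1) j))
      (fun _ _ => rfl))
    (by
      rw [AddSubgroup.zmultiples_le]
      exact AddSubgroup.mem_zmultiples _)

/-- The ring automorphism of `R(T)` exchanging `a_i` and `a_{i+1}`. -/
noncomputable def reflRT (n : ℕ) (i : ZMod n) : RT n →+* RT n :=
  AddMonoidAlgebra.mapDomainRingHom ℤ (reflChar n i)

/-! ### Power series in `y` and the Demazure operators -/

/-- Formal power series in the infinitely many variables `y` (here `y 0, y 1, …`) over `R(T)`. -/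
abbrev PS (n : ℕ) : Type := MvPowerSeries ℕ (RT n)

/-- `Ω(c|y) = ∏_j 1 / (1 - c y_j)`: since `1 / (1 - c y_j) = ∑_r c ^ r y_j ^ r`, the coefficient of
a monomial of total degree `d` in the product is `c ^ d`. -/
noncomputable def Omega {n : ℕ} (c : RT n) : PS n := fun m => c ^ m.degree

/-- The action of the simple reflection `s_i` on power series: it exchanges `a_i` and `a_{i+1}` in
the coefficients, and `s_0 f = (Ω(b_1|y) / Ω(b_n|y)) s_θ f`.  (The constant coefficient of
`Ω(b_n|y)` is `1`, so `invOfUnit _ 1` is its inverse.) -/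
noncomputable def refl (n : ℕ) (i : ZMod n) (f : PS n) : PS n :=
  if i = 0 then
    Omega (b n 1) * MvPowerSeries.invOfUnit (Omega (b n 0)) 1 * MvPowerSeries.map (reflRT n 0) f
  else MvPowerSeries.map (reflRT n i) f

theorem ex_add {n : ℕ} (v w : CharLattice n) : ex (v + w) = ex v * ex w := by
  simp [ex, AddMonoidAlgebra.single_mul_single]

theorem ex_zero {n : ℕ} : ex (0 : CharLattice n) = 1 := rfl

/-- On characters, the reflection `s_i` changes `v` by a multiple of `α_i`. -/
theorem reflChar_eq (n : ℕ) (i : ZMod n) (v : CharLattice n) :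
    ∃ m : ℤ, reflChar n i v = v + m • simpleRoot n i := by
  induction v using QuotientAddGroup.induction_on with
  | H v =>
    refine ⟨v (i + 1) - v i, ?_⟩
    change QuotientAddGroup.mk _ = QuotientAddGroup.mk
      (v + (v (i + 1) - v i) • (Pi.single i 1 - Pi.single (i + 1) 1))
    congr 1
    funext j
    by_cases h : i = i + 1
    · simp [← h]
    · by_cases h1 : j = i
      · subst h1
        simp [h]
      · by_cases h2 : j = i + 1
        · subst h2
          simp [Ne.symm h]
        · simp [Equiv.swap_apply_of_ne_of_ne h1 h2, h1, h2]

/-- `s_i f - f` is divisible by `1 - e^{α_i}`, so that the Demazure operators are defined on power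
series over `R(T)`. -/
theorem exists_demazure (n : ℕ) (i : ZMod n) (f : PS n) :
    ∃ q : PS n, MvPowerSeries.C (1 - ex (simpleRoot n i)) * q = refl n i f - f := by
  set α := simpleRoot n i with hα
  obtain ⟨Q, _, π, hker⟩ : ∃ (Q : Type) (_ : CommRing Q) (π : RT n →+* Q),
      ∀ r, π r = 0 ↔ (1 - ex α) ∣ r :=
    ⟨RT n ⧸ Ideal.span {1 - ex α}, inferInstance, Ideal.Quotient.mk _, fun r => by
      rw [Ideal.Quotient.eq_zero_iff_mem, Ideal.mem_span_singleton]⟩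
  have hπα : π (ex α) = 1 := by
    have : π (1 - ex α) = 0 := (hker _).2 dvd_rfl
    rw [map_sub, map_one, sub_eq_zero] at this
    exact this.symm
  have hn : ∀ m : ℕ, π (ex (m • α)) = 1 := by
    intro m
    induction m with
    | zero => simp [ex_zero]
    | succ m ih => rw [succ_nsmul, ex_add, map_mul, ih, hπα, one_mul]
  have hz : ∀ m : ℤ, π (ex (m • α)) = 1 := by
    intro m
    obtain ⟨k, rfl | rfl⟩ := m.eq_nat_or_neg
    · simpa using hn k
    · have h1 := hn k
      have h2 : π (ex (k • α)) * π (ex (-(k • α))) = 1 := by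
        rw [← map_mul, ← ex_add, add_neg_cancel, ex_zero, map_one]
      rw [h1, one_mul] at h2
      simpa using h2
  have hs : ∀ r : RT n, π (reflRT n i r) = π r := by
    intro r
    induction r using AddMonoidAlgebra.induction_linear with
    | zero => simp
    | add x y hx hy => simp [hx, hy]
    | single v c =>
      obtain ⟨m, hm⟩ := reflChar_eq n i v
      have h1 : reflRT n i (AddMonoidAlgebra.single v c) = c • (ex v * ex (m • α)) := by
        rw [← ex_add, ← hm]
        simp [reflRT, ex]
      have h2 : (AddMonoidAlgebra.single v c : RT n) = c • ex v := by simp [ex]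
      rw [h1, h2, map_zsmul, map_zsmul, map_mul, hz, mul_one]
  have hmap : ∀ g : PS n, MvPowerSeries.map π (MvPowerSeries.map (reflRT n i) g) =
      MvPowerSeries.map π g := by
    intro g
    ext m
    simp [hs]
  have hdiff : MvPowerSeries.map π (refl n i f) = MvPowerSeries.map π f := by
    unfold refl
    split_ifs with h0
    · have hb : π (b n 1) = π (b n 0) := by
        have h1 : -a n 0 = -a n 1 + (-1 : ℤ) • α := by
          rw [hα, h0]
          simp only [simpleRoot, zero_add, neg_smul, one_smul]
          abel
        rw [b, b, h1, ex_add, map_sub, map_sub, map_mul, hz, mul_one]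
      have hO : MvPowerSeries.map π (Omega (b n 1)) = MvPowerSeries.map π (Omega (b n 0)) := by
        ext m
        change π (b n 1 ^ _) = π (b n 0 ^ _)
        rw [map_pow, map_pow, hb]
      have hinv : Omega (b n 0) * MvPowerSeries.invOfUnit (Omega (b n 0)) 1 = 1 := by
        apply MvPowerSeries.mul_invOfUnit
        change b n 0 ^ (0 : ℕ →₀ ℕ).degree = 1
        simp
      have hm0 := hmap f
      rw [h0] at hm0
      rw [map_mul, map_mul, hO, ← map_mul, hinv, map_one, one_mul, hm0]
    · exact hmap f
  have hdvd : ∀ m, ∃ q, (1 - ex α) * q = (refl n i f - f) m := by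
    intro m
    have h : π ((refl n i f - f) m) = 0 := by
      have := congrArg (MvPowerSeries.coeff m) hdiff
      rw [MvPowerSeries.coeff_map, MvPowerSeries.coeff_map, ← sub_eq_zero, ← map_sub] at this
      exact this
    obtain ⟨q, hq⟩ := (hker _).1 h
    exact ⟨q, hq.symm⟩
  choose q hq using hdvd
  let q' : PS n := q
  refine ⟨q', MvPowerSeries.ext fun m => ?_⟩
  rw [MvPowerSeries.coeff_C_mul]
  exact hq m

/-- The Demazure operator `T_i = (1 - e^{α_i})⁻¹ (s_i - 1)`: the quotient exists by
`exists_demazure` and is unique for `n ≥ 2` by `T_unique`. -/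
noncomputable def T (n : ℕ) (i : ZMod n) (f : PS n) : PS n := (exists_demazure n i f).choose

theorem T_spec (n : ℕ) (i : ZMod n) (f : PS n) :
    MvPowerSeries.C (1 - ex (simpleRoot n i)) * T n i f = refl n i f - f :=
  (exists_demazure n i f).choose_spec

theorem charLattice_torsionFree (n : ℕ) (v : CharLattice n) (m : ℕ) (hm : m ≠ 0)
    (h : m • v = 0) : v = 0 := by
  induction v using QuotientAddGroup.induction_on with
  | H v =>
    obtain ⟨c, hc⟩ := AddSubgroup.mem_zmultiples_iff.1
      ((QuotientAddGroup.eq_zero_iff (m • v)).1 h)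
    refine (QuotientAddGroup.eq_zero_iff v).2 (AddSubgroup.mem_zmultiples_iff.2 ⟨v 0, ?_⟩)
    funext j
    have h0 := congrFun hc 0
    have hj := congrFun hc j
    simp only [Pi.smul_apply, smul_eq_mul, mul_one, nsmul_eq_mul] at h0 hj ⊢
    exact mul_left_cancel₀ (Nat.cast_ne_zero.2 hm) (h0.symm.trans hj)

instance (n : ℕ) : IsAddTorsionFree (CharLattice n) where
  nsmul_right_injective m hm v w h := by
    have h' : m • (v - w) = 0 := by rw [nsmul_sub, sub_eq_zero]; exact h
    exact sub_eq_zero.1 (charLattice_torsionFree n _ m hm h')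

/-- For `n ≥ 2`, `T_i f` is the only solution of `(1 - e^{α_i}) q = s_i f - f`. -/
theorem T_unique (n : ℕ) (hn : 2 ≤ n) (i : ZMod n) (f q : PS n)
    (h : MvPowerSeries.C (1 - ex (simpleRoot n i)) * q = refl n i f - f) : T n i f = q := by
  have : NeZero n := ⟨by omega⟩
  have : Fact (1 < n) := ⟨hn⟩
  have hne : (1 - ex (simpleRoot n i) : RT n) ≠ 0 := by
    intro h0
    have h1 : ex (simpleRoot n i) = ex 0 := (sub_eq_zero.1 h0).symm
    have h2 : simpleRoot n i = 0 := by
      have := congrArg AddMonoidAlgebra.coeff h1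
      simp only [ex, AddMonoidAlgebra.coeff_single] at this
      exact Finsupp.single_left_injective one_ne_zero this
    have h3 : QuotientAddGroup.mk (Pi.single i 1 - Pi.single (i + 1) 1) =
      (0 : CharLattice n) := h2
    obtain ⟨c, hc⟩ := AddSubgroup.mem_zmultiples_iff.1 ((QuotientAddGroup.eq_zero_iff _).1 h3)
    have hi := congrFun hc i
    have hi' := congrFun hc (i + 1)
    simp at hi hi'
    omega
  refine MvPowerSeries.ext fun m => ?_
  have h1 := congrArg (MvPowerSeries.coeff m) ((T_spec n i f).trans h.symm)
  rw [MvPowerSeries.coeff_C_mul, MvPowerSeries.coeff_C_mul] at h1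
  exact mul_left_cancel₀ hne h1

/-- The Demazure operator `D_i = T_i + 1`. -/
noncomputable def D (n : ℕ) (i : ZMod n) (f : PS n) : PS n := T n i f + f

/-! ### Bounded partitions and the `K`-theoretic double `k`-Schur functions

A partition is a Young diagram with boxes `(i, j)` (row, column), rows and columns counted from
`0`; throughout `k = n - 1`. -/

/-- `λ` is `k`-bounded: `λ_1 ≤ k = n - 1`. -/
def IsKBounded (n : ℕ) (lam : YoungDiagram) : Prop := lam.rowLen 0 ≤ n - 1

/-- `λ` is `k`-small: it is `k`-bounded and `λ_1 + ℓ(λ) ≤ n`. -/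
def IsKSmall (n : ℕ) (lam : YoungDiagram) : Prop :=
  IsKBounded n lam ∧ lam.rowLen 0 + lam.colLen 0 ≤ n

/-- The `n`-residue `j - i mod n` of the box in row `i` and column `j`. -/
def res (n : ℕ) (i j : ℕ) : ZMod n := (j : ZMod n) - (i : ZMod n)

/-- The reduced word `i_1, …, i_l` of the affine Grassmannian element
`x_λ = s_{i_1} ⋯ s_{i_l}` corresponding to a `k`-bounded partition `λ`: the residues of the boxes,
each row read from right to left, starting with the bottom row (so `i_l = 0` belongs to the corner
box). -/
def redWord (n : ℕ) (lam : YoungDiagram) : List (ZMod n) :=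
  ((List.range (lam.colLen 0)).flatMap fun i =>
    (List.range (lam.rowLen i)).map fun j => res n i j).reverse

/-- The `K`-theoretic double `k`-Schur function
`g_λ(y|b) = T_{x_λ}(1) = T_{i_1} ⋯ T_{i_l}(1)`. -/
noncomputable def g (n : ℕ) (lam : YoungDiagram) : PS n := (redWord n lam).foldr (T n) 1

/-- The closed `K`-theoretic double `k`-Schur function
`g̃_λ(y|b) = D_{x_λ}(1) = D_{i_1} ⋯ D_{i_l}(1)`. -/
noncomputable def gTilde (n : ℕ) (lam : YoungDiagram) : PS n := (redWord n lam).foldr (D n) 1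

/-- `∏_{x ∈ diag(λ)} e^{a_{r(x)+1} - a_{b(x)}}`, where for the diagonal box `x = (i, i)` the
residues `r(x)` and `b(x)` are those of the last box of row `i` and of the last box of
column `i`. -/
noncomputable def diagMonomial (n : ℕ) (lam : YoungDiagram) : RT n :=
  ∏ x ∈ lam.cells.filter (fun x => x.1 = x.2),
    ex (a n (res n x.1 (lam.rowLen x.1 - 1) + 1) - a n (res n (lam.colLen x.2 - 1) x.2))

/-! ### The substitution `σ : f(y) ↦ f(1, y)` -/

/-- The augmentation ideal of `R(T)`, generated by `b_1, …, b_n`. -/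
noncomputable def augIdeal (n : ℕ) : Ideal (RT n) := Ideal.span (Set.range (b n))

/-- The exponent of the monomial `y_0 ^ j · y_1 ^ {m 0} · y_2 ^ {m 1} ⋯`. -/
noncomputable def consExp (j : ℕ) (m : ℕ →₀ ℕ) : ℕ →₀ ℕ :=
  Finsupp.single 0 j + m.mapDomain Nat.succ

/-- `σ(f) = F`, where `σ : f(y_1, y_2, …) ↦ f(1, y_1, y_2, …)` is the `R(T)`-linear substitution.
The coefficient of `y ^ m` in `f(1, y)` is the sum over `j` of the coefficients in `f` of
`y_1 ^ j` times the shifted monomial `y ^ m`; these infinite sums (for instance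
`∑_j b_i ^ j = (1 - b_i)⁻¹ = e^{a_i}`, giving `σ(Ω(b_i|y)) = e^{a_i} Ω(b_i|y)`) are required to
converge in `R(T)`, in the `(b_1, …, b_n)`-adic topology, to the coefficients of `F`. -/
def IsSigma {n : ℕ} (f F : PS n) : Prop :=
  ∀ m : ℕ →₀ ℕ, ∀ N : ℕ, ∃ J₀ : ℕ, ∀ J ≥ J₀,
    (∑ j ∈ Finset.range J, MvPowerSeries.coeff (consExp j m) f) - MvPowerSeries.coeff m F ∈
      augIdeal n ^ N

end DoubleKSchur

namespace DoubleKSchur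

open MvPowerSeries

/-! ### The representation ring and its augmentation ideal -/

/-! Everything follows from how `σ` commutes with the reflections. Since `σ(Ω(b_i) f) = e^{a_i}
Ω(b_i) σ(f)`, `σ` commutes with `s_i` for `i ≠ 0`, while `σ s_0 = e^{-α_0} s_0 σ`. As `D_i = (1 -
e^{α_i})⁻¹ (s_i - e^{α_i})`, this gives `σ T_i = T_i σ` for `i ≠ 0` and `σ T_0 = e^{-α_0} D_0 σ`
(`IsSigma.T`). So `σ(g_λ)` is the word of `λ` in the operators `sigmaT`, applied to `1`.

For `i ≠ 0` and `s_i v = v - α_i` one has `T_i(e^v f) = e^{v - α_i} D_i f`; the case `i = 0` has the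
same shape once `s_0` acts on characters at level one (`sigmaT_C_mul`). For `k`-small `λ` the
condition on `v` holds at every box (`levelOneRefl_partialWeight`), so each letter becomes a `D_i`
and the exponentials accumulate to `-∑ α_r` over the boxes. Summed hook by hook, this is the
diagonal monomial (`sum_cells_eq_sum_diag`).

For `(2, 1)` and `n = 3` the last letter meets `s_2 v = v - 2 α_2`, which produces one extra term.
Coefficients of degree at most one show that it cannot be absorbed into a scalar.

Convergence is adic in a Noetherian domain: Artin–Rees allows division by `1 - e^{α_i}`, and Krull's
intersection theorem makes limits unique. -/

theorem reflChar_a (n : ℕ) (i j : ZMod n) :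
    reflChar n i (a n j) = a n (Equiv.swap i (i + 1) j) := by
  change QuotientAddGroup.mk _ = QuotientAddGroup.mk _
  congr 1
  funext l
  change (Pi.single j 1 : ZMod n → ℤ) (Equiv.swap i (i + 1) l) = _
  simp only [Pi.single_apply, Equiv.swap_apply_eq_iff]

theorem reflRT_ex (n : ℕ) (i : ZMod n) (v : CharLattice n) :
    reflRT n i (ex v) = ex (reflChar n i v) := by
  simp [reflRT, ex]

theorem ex_mul_ex_neg {n : ℕ} (v : CharLattice n) : ex v * ex (-v) = 1 := by
  rw [← ex_add, add_neg_cancel, ex_zero]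

theorem ex_injective (n : ℕ) : Function.Injective (ex : CharLattice n → RT n) := by
  intro v w h
  have := congrArg AddMonoidAlgebra.coeff h
  simp only [ex, AddMonoidAlgebra.coeff_single] at this
  exact Finsupp.single_left_injective one_ne_zero this

theorem a_injective (n : ℕ) (hn : 3 ≤ n) : Function.Injective (a n) := by
  intro i j h
  by_contra hij
  have : NeZero n := ⟨by omega⟩
  obtain ⟨c, hc⟩ := AddSubgroup.mem_zmultiples_iff.1 (QuotientAddGroup.eq.1 h)
  -- At a third coordinate both unit vectors vanish, which forces the multiple `c` of `(1, …, 1)` to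
  -- be zero.
  obtain ⟨l, hl⟩ : ∃ l, l ∉ ({i, j} : Finset (ZMod n)) := by
    by_contra! hall
    have h1 := Finset.card_le_card (fun x _ => hall x : Finset.univ ⊆ ({i, j} : Finset (ZMod n)))
    rw [Finset.card_univ, ZMod.card] at h1
    have := Finset.card_le_two (a := i) (b := j)
    omega
  simp only [Finset.mem_insert, Finset.mem_singleton, not_or] at hl
  have h0 := congrFun hc l
  have h1 := congrFun hc i
  simp [hl.1, hl.2, hij] at h0 h1
  omega

theorem one_sub_ex_simpleRoot_ne_zero (n : ℕ) (hn : 2 ≤ n) (i : ZMod n) :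
    (1 - ex (simpleRoot n i) : RT n) ≠ 0 := by
  have : NeZero n := ⟨by omega⟩
  have : Fact (1 < n) := ⟨hn⟩
  intro h0
  have h2 : simpleRoot n i = 0 := ex_injective n (sub_eq_zero.1 h0).symm
  obtain ⟨c, hc⟩ := AddSubgroup.mem_zmultiples_iff.1 ((QuotientAddGroup.eq_zero_iff
    (Pi.single i 1 - Pi.single (i + 1) 1 : ZMod n → ℤ)).1 h2)
  have hi := congrFun hc i
  have hi' := congrFun hc (i + 1)
  simp at hi hi'
  omega

instance isNoetherianRing_RT (n : ℕ) [NeZero n] : IsNoetherianRing (RT n) := by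
  have : Module.Finite ℤ (CharLattice n) :=
    Module.Finite.of_surjective
      ((QuotientAddGroup.mk' (AddSubgroup.zmultiples (fun _ => 1 : ZMod n → ℤ))).toIntLinearMap)
      (QuotientAddGroup.mk'_surjective _)
  have : AddMonoid.FG (CharLattice n) :=
    AddGroup.fg_iff_addMonoid_fg.1 (Module.Finite.iff_addGroup_fg.1 this)
  exact Algebra.FiniteType.isNoetherianRing ℤ (RT n)

/-- The augmentation `e^v ↦ 1`. -/
noncomputable def augmentation (n : ℕ) : RT n →ₐ[ℤ] ℤ := AddMonoidAlgebra.lift ℤ ℤ (CharLattice n) 1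

theorem augmentation_ex {n : ℕ} (v : CharLattice n) : augmentation n (ex v) = 1 := by
  simp [augmentation, ex]

theorem augIdeal_ne_top (n : ℕ) : augIdeal n ≠ ⊤ := by
  have hle : augIdeal n ≤ RingHom.ker (augmentation n) := by
    rw [augIdeal, Ideal.span_le]
    rintro _ ⟨i, rfl⟩
    simp [RingHom.mem_ker, b, augmentation_ex]
  intro h
  have : (1 : RT n) ∈ RingHom.ker (augmentation n) := hle (h ▸ trivial)
  simp [RingHom.mem_ker] at this

theorem b_mem_augIdeal (n : ℕ) (i : ZMod n) : b n i ∈ augIdeal n :=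
  Ideal.subset_span ⟨i, rfl⟩

theorem reflRT_b (n : ℕ) (i j : ZMod n) : reflRT n i (b n j) = b n (Equiv.swap i (i + 1) j) := by
  rw [b, map_sub, map_one, reflRT_ex, map_neg, reflChar_a, b]

theorem reflRT_mem_augIdeal_pow (n : ℕ) (i : ZMod n) (N : ℕ) {x : RT n} (hx : x ∈ augIdeal n ^ N) :
    reflRT n i x ∈ augIdeal n ^ N := by
  have hle : (augIdeal n).map (reflRT n i) ≤ augIdeal n := by
    rw [Ideal.map_le_iff_le_comap, augIdeal, Ideal.span_le]
    rintro _ ⟨j, rfl⟩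
    rw [SetLike.mem_coe, Ideal.mem_comap, reflRT_b]
    exact b_mem_augIdeal n _
  have h := Ideal.mem_map_of_mem (reflRT n i) hx
  rw [Ideal.map_pow] at h
  exact Ideal.pow_right_mono hle N h

/-- A nonzero factor can be cancelled at the cost of a bounded loss of adic precision. -/
theorem exists_forall_mem_of_mul_mem (n : ℕ) [NeZero n] {c : RT n} (hc : c ≠ 0) :
    ∃ k, ∀ N x, c * x ∈ augIdeal n ^ (N + k) → x ∈ augIdeal n ^ N := by
  -- Artin–Rees for the ideal `(c)`: `I^(N+k) ∩ (c)` lies in `I^N · (c)`, and `c` cancels because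
  -- `R(T)` is a domain.
  obtain ⟨k, hk⟩ := Ideal.exists_pow_inf_eq_pow_smul (augIdeal n) (Ideal.span {c})
  refine ⟨k, fun N x hx => ?_⟩
  have h1 : c * x ∈ augIdeal n ^ (N + k) • (⊤ : Ideal (RT n)) ⊓ Ideal.span {c} := by
    refine ⟨?_, Ideal.mem_span_singleton.2 ⟨x, rfl⟩⟩
    rw [smul_eq_mul, Ideal.mul_top]
    exact hx
  rw [hk _ (Nat.le_add_left _ _), Nat.add_sub_cancel] at h1
  have h2 : c * x ∈ augIdeal n ^ N * Ideal.span {c} := Ideal.mul_mono_right inf_le_right h1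
  obtain ⟨z, hz, hzx⟩ := Ideal.mem_mul_span_singleton.1 h2
  rw [mul_comm] at hzx
  rwa [← mul_left_cancel₀ hc hzx]

/-! ### Adic convergence of power series -/

/-- Coefficientwise convergence in the `(b_1, …, b_n)`-adic topology. -/
def AdicLim {n : ℕ} (u : ℕ → PS n) (U : PS n) : Prop :=
  ∀ m : ℕ →₀ ℕ, ∀ N : ℕ, ∃ J₀ : ℕ, ∀ J ≥ J₀, coeff m (u J) - coeff m U ∈ augIdeal n ^ N

namespace AdicLim

variable {n : ℕ} {u v : ℕ → PS n} {U V : PS n}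

theorem sub (hu : AdicLim u U) (hv : AdicLim v V) : AdicLim (fun J => u J - v J) (U - V) := by
  intro m N
  obtain ⟨J₁, h₁⟩ := hu m N
  obtain ⟨J₂, h₂⟩ := hv m N
  refine ⟨max J₁ J₂, fun J hJ => ?_⟩
  have := Ideal.sub_mem _ (h₁ J (le_of_max_le_left hJ)) (h₂ J (le_of_max_le_right hJ))
  rw [map_sub, map_sub]
  convert this using 1
  ring

theorem mul_left (A : PS n) (hu : AdicLim u U) : AdicLim (fun J => A * u J) (A * U) := by
  intro m N
  choose J₀ h using fun p : (ℕ →₀ ℕ) × (ℕ →₀ ℕ) => hu p.2 N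
  -- A coefficient of a product involves finitely many coefficients of `u J`, so a common threshold
  -- exists.
  refine ⟨(Finset.HasAntidiagonal.antidiagonal m).sup J₀, fun J hJ => ?_⟩
  rw [coeff_mul, coeff_mul, ← Finset.sum_sub_distrib]
  refine Ideal.sum_mem _ fun p hp => ?_
  rw [← mul_sub]
  exact Ideal.mul_mem_left _ _ (h p J ((Finset.le_sup hp).trans hJ))

theorem shift (hu : AdicLim u U) : AdicLim (fun J => u (J + 1)) U := by
  intro m N
  obtain ⟨J₀, h⟩ := hu m N
  exact ⟨J₀, fun J hJ => h _ (by omega)⟩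

theorem of_shift (hu : AdicLim (fun J => u (J + 1)) U) : AdicLim u U := by
  intro m N
  obtain ⟨J₀, h⟩ := hu m N
  refine ⟨J₀ + 1, fun J hJ => ?_⟩
  obtain ⟨J, rfl⟩ := Nat.exists_eq_add_of_le' (show 1 ≤ J by omega)
  exact h J (by omega)

theorem map_reflRT (i : ZMod n) (hu : AdicLim u U) :
    AdicLim (fun J => MvPowerSeries.map (reflRT n i) (u J)) (MvPowerSeries.map (reflRT n i) U) := by
  intro m N
  obtain ⟨J₀, h⟩ := hu m N
  refine ⟨J₀, fun J hJ => ?_⟩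
  rw [coeff_map, coeff_map, ← map_sub]
  exact reflRT_mem_augIdeal_pow n i N (h J hJ)

theorem of_C_mul [NeZero n] {c : RT n} (hc : c ≠ 0)
    (hu : AdicLim (fun J => C c * u J) (C c * U)) : AdicLim u U := by
  obtain ⟨k, hk⟩ := exists_forall_mem_of_mul_mem n hc
  intro m N
  obtain ⟨J₀, h⟩ := hu m (N + k)
  refine ⟨J₀, fun J hJ => hk _ _ ?_⟩
  have := h J hJ
  rwa [coeff_C_mul, coeff_C_mul, ← mul_sub] at this

theorem unique [NeZero n] (hU : AdicLim u U) (hV : AdicLim u V) : U = V := by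
  refine MvPowerSeries.ext fun m => sub_eq_zero.1 ?_
  -- Krull's intersection theorem: the powers of a proper ideal in a Noetherian domain meet in zero.
  rw [← Ideal.mem_bot, ← Ideal.iInf_pow_eq_bot_of_isDomain (augIdeal n) (augIdeal_ne_top n),
    Ideal.mem_iInf]
  intro N
  obtain ⟨J₀, h⟩ := (hV.sub hU) m N
  simpa using h J₀ le_rfl

/-- If `u` converges and `w (J + 1) = u (J + 1) + c w J` with `c` topologically nilpotent, then `w`
converges to `(1 - c)⁻¹ lim u`. -/
theorem of_recurrence {w : ℕ → PS n} {c e : RT n} (hc : c ∈ augIdeal n) (he : (1 - c) * e = 1)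
    (hw : ∀ J, w (J + 1) = u (J + 1) + C c * w J) (hu : AdicLim u U) : AdicLim w (C e * U) := by
  intro m N
  obtain ⟨J₀, h⟩ := hu m N
  -- The error satisfies `E (J + 1) = (u (J + 1) - U) + c E J`, so each step past `J₀` gains one
  -- power of the ideal, up to `N`.
  have key : ∀ t, t ≤ N → ∀ J, J₀ + t ≤ J →
      coeff m (w J) - coeff m (C e * U) ∈ augIdeal n ^ t := by
    intro t
    induction t with
    | zero => intro _ J _; simp
    | succ t ih =>
      intro ht J hJ
      obtain ⟨J, rfl⟩ := Nat.exists_eq_add_of_le' (show 1 ≤ J by omega)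
      have h1 := Ideal.pow_le_pow_right ht (h (J + 1) (by omega))
      have h2 : (coeff m (w J) - coeff m (C e * U)) * c ∈ augIdeal n ^ (t + 1) := by
        rw [Ideal.IsTwoSided.pow_succ, mul_comm]
        exact Ideal.mul_mem_mul hc (ih (by omega) J (by omega))
      convert Ideal.add_mem _ h1 h2 using 1
      rw [hw, map_add, coeff_C_mul, coeff_C_mul]
      linear_combination (-coeff m U) * he
  exact ⟨J₀ + N, fun J hJ => key N le_rfl J hJ⟩

end AdicLim

/-! ### The expansion of a power series in its first variable -/

/-- The coefficient of `y_0 ^ j` in `f`, as a series in the remaining variables. -/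
noncomputable def slice {n : ℕ} (j : ℕ) (f : PS n) : PS n := fun m => coeff (consExp j m) f

theorem coeff_slice {n : ℕ} (j : ℕ) (f : PS n) (m : ℕ →₀ ℕ) :
    coeff m (slice j f) = coeff (consExp j m) f := rfl

/-- The sum of the coefficients of `y_0 ^ j` in `f` over `j < J`. -/
noncomputable def sliceSum {n : ℕ} (f : PS n) (J : ℕ) : PS n := ∑ j ∈ Finset.range J, slice j f

theorem isSigma_iff {n : ℕ} (f F : PS n) : IsSigma f F ↔ AdicLim (sliceSum f) F := by
  simp only [IsSigma, AdicLim, sliceSum, map_sum, coeff_slice]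

theorem consExp_zero_apply (j : ℕ) (m : ℕ →₀ ℕ) : consExp j m 0 = j := by
  have : Finsupp.mapDomain Nat.succ m 0 = 0 := Finsupp.mapDomain_of_notMem_range _ _ (by simp)
  simp [consExp, this]

theorem consExp_succ_apply (j : ℕ) (m : ℕ →₀ ℕ) (i : ℕ) : consExp j m (i + 1) = m i := by
  have : Finsupp.mapDomain Nat.succ m (i + 1) = m i :=
    Finsupp.mapDomain_apply Nat.succ_injective m i
  simp [consExp, this]

theorem consExp_injective {j j' : ℕ} {m m' : ℕ →₀ ℕ} (h : consExp j m = consExp j' m') :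
    j = j' ∧ m = m' := by
  refine ⟨by rw [← consExp_zero_apply j m, h, consExp_zero_apply], ?_⟩
  ext i
  rw [← consExp_succ_apply j m, h, consExp_succ_apply]

theorem exists_eq_consExp (x : ℕ →₀ ℕ) : ∃ j m, x = consExp j m := by
  refine ⟨x 0, x.comapDomain Nat.succ Nat.succ_injective.injOn, ?_⟩
  ext i
  cases i with
  | zero => rw [consExp_zero_apply]
  | succ i => rw [consExp_succ_apply, Finsupp.comapDomain_apply]

theorem consExp_add (j j' : ℕ) (m m' : ℕ →₀ ℕ) :
    consExp (j + j') (m + m') = consExp j m + consExp j' m' := by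
  ext i
  cases i with
  | zero => simp [consExp_zero_apply]
  | succ i => simp [consExp_succ_apply]

theorem degree_consExp (j : ℕ) (m : ℕ →₀ ℕ) : (consExp j m).degree = j + m.degree := by
  rw [consExp, map_add, Finsupp.degree_single]
  congr 1
  exact Finsupp.degree_mapDomain _ _

theorem slice_mul {n : ℕ} (j : ℕ) (f f' : PS n) :
    slice j (f * f') = ∑ p ∈ Finset.HasAntidiagonal.antidiagonal j, slice p.1 f * slice p.2 f' := by
  refine MvPowerSeries.ext fun m => ?_
  rw [coeff_slice, coeff_mul, map_sum]
  simp only [coeff_mul, coeff_slice]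
  rw [← Finset.sum_product']
  symm
  refine Finset.sum_bij (fun x _ => (consExp x.1.1 x.2.1, consExp x.1.2 x.2.2)) ?_ ?_ ?_ ?_
  · rintro ⟨⟨j₁, j₂⟩, m₁, m₂⟩ h
    simp only [Finset.mem_product, Finset.HasAntidiagonal.mem_antidiagonal] at h ⊢
    rw [← consExp_add, h.1, h.2]
  · rintro ⟨⟨j₁, j₂⟩, m₁, m₂⟩ _ ⟨⟨j₁', j₂'⟩, m₁', m₂'⟩ _ h
    simp only [Prod.mk.injEq] at h ⊢
    obtain ⟨h₁, h₂⟩ := consExp_injective h.1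
    obtain ⟨h₃, h₄⟩ := consExp_injective h.2
    exact ⟨⟨h₁, h₃⟩, h₂, h₄⟩
  · rintro ⟨x, x'⟩ h
    obtain ⟨j₁, m₁, rfl⟩ := exists_eq_consExp x
    obtain ⟨j₂, m₂, rfl⟩ := exists_eq_consExp x'
    rw [Finset.HasAntidiagonal.mem_antidiagonal, ← consExp_add] at h
    obtain ⟨h₁, h₂⟩ := consExp_injective h
    exact ⟨((j₁, j₂), m₁, m₂), by simp [h₁, h₂], rfl⟩
  · intros; rfl

theorem slice_Omega {n : ℕ} (j : ℕ) (c : RT n) : slice j (Omega c) = C (c ^ j) * Omega c := by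
  refine MvPowerSeries.ext fun m => ?_
  rw [coeff_C_mul]
  change c ^ _ = c ^ j * c ^ _
  rw [degree_consExp, pow_add]

theorem slice_zero_Omega_mul {n : ℕ} (c : RT n) (f : PS n) :
    slice 0 (Omega c * f) = Omega c * slice 0 f := by
  simp [slice_mul, slice_Omega]

/-- This is `(1 - c y_0) Ω(c|y_0, y') = Ω(c|y')` read off in powers of `y_0`. It replaces the
summation of a geometric series by a recurrence. -/
theorem slice_succ_Omega_mul {n : ℕ} (j : ℕ) (c : RT n) (f : PS n) :
    slice (j + 1) (Omega c * f) = Omega c * slice (j + 1) f + C c * slice j (Omega c * f) := by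
  rw [slice_mul, Finset.Nat.sum_antidiagonal_succ, slice_mul, Finset.mul_sum, slice_Omega, pow_zero,
    map_one, one_mul]
  refine congrArg _ (Finset.sum_congr rfl fun p _ => ?_)
  rw [slice_Omega, slice_Omega, pow_succ, map_mul, mul_comm (C (c ^ p.1)), mul_assoc, mul_assoc,
    mul_assoc]

theorem sliceSum_Omega_mul {n : ℕ} (c : RT n) (f : PS n) (J : ℕ) :
    sliceSum (Omega c * f) (J + 1) =
      Omega c * sliceSum f (J + 1) + C c * sliceSum (Omega c * f) J := by
  simp only [sliceSum, Finset.sum_range_succ' _ J, slice_zero_Omega_mul, slice_succ_Omega_mul,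
    Finset.sum_add_distrib, Finset.mul_sum, mul_add]
  ring

theorem sliceSum_C_mul {n : ℕ} (c : RT n) (f : PS n) (J : ℕ) :
    sliceSum (C c * f) J = C c * sliceSum f J := by
  refine MvPowerSeries.ext fun m => ?_
  simp [sliceSum, coeff_slice, Finset.mul_sum]

theorem sliceSum_map {n : ℕ} (i : ZMod n) (f : PS n) (J : ℕ) :
    sliceSum (MvPowerSeries.map (reflRT n i) f) J = MvPowerSeries.map (reflRT n i) (sliceSum f J) := by
  refine MvPowerSeries.ext fun m => ?_
  simp [sliceSum, coeff_slice]

theorem sliceSum_sub {n : ℕ} (f f' : PS n) (J : ℕ) :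
    sliceSum (f - f') J = sliceSum f J - sliceSum f' J := by
  refine MvPowerSeries.ext fun m => ?_
  simp [sliceSum, coeff_slice]

/-! ### Compatibility of `σ` with the reflections and the Demazure operators -/

theorem Omega_mul_invOfUnit {n : ℕ} (c : RT n) : Omega c * invOfUnit (Omega c) 1 = 1 := by
  apply mul_invOfUnit
  change c ^ (0 : ℕ →₀ ℕ).degree = 1
  simp

theorem one_sub_b_mul_ex (n : ℕ) (i : ZMod n) : (1 - b n i) * ex (a n i) = 1 := by
  rw [b, sub_sub_cancel, mul_comm, ex_mul_ex_neg]

namespace IsSigma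

variable {n : ℕ} {f f' F F' : PS n}

theorem one : IsSigma (1 : PS n) 1 := by
  intro m N
  refine ⟨1, fun J hJ => ?_⟩
  have h : ∑ j ∈ Finset.range J, coeff (consExp j m) (1 : PS n) = coeff m (1 : PS n) := by
    rw [Finset.sum_eq_single_of_mem 0 (Finset.mem_range.2 hJ)]
    · classical
      rw [coeff_one, coeff_one]
      refine if_congr ⟨fun h => ?_, fun h => ?_⟩ rfl rfl
      · ext i
        simpa [consExp_succ_apply] using DFunLike.congr_fun h (i + 1)
      · simp [h, consExp]
    · intro j _ hj
      classical
      rw [coeff_one, if_neg]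
      intro h
      exact hj (by simpa [consExp_zero_apply] using DFunLike.congr_fun h 0)
  rw [h, sub_self]
  exact Ideal.zero_mem _

theorem sub (h : IsSigma f F) (h' : IsSigma f' F') : IsSigma (f - f') (F - F') := by
  rw [isSigma_iff] at h h' ⊢
  simpa only [← sliceSum_sub] using h.sub h'

theorem map_reflRT (i : ZMod n) (h : IsSigma f F) :
    IsSigma (MvPowerSeries.map (reflRT n i) f) (MvPowerSeries.map (reflRT n i) F) := by
  rw [isSigma_iff] at h ⊢
  simpa only [← sliceSum_map] using h.map_reflRT i

theorem of_C_mul [NeZero n] {c : RT n} (hc : c ≠ 0) (h : IsSigma (C c * f) (C c * F)) :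
    IsSigma f F := by
  rw [isSigma_iff] at h ⊢
  refine AdicLim.of_C_mul hc ?_
  simpa only [← sliceSum_C_mul] using h

theorem unique [NeZero n] (h : IsSigma f F) (h' : IsSigma f F') : F = F' := by
  rw [isSigma_iff] at h h'
  exact h.unique h'

/-- The recurrence has ratio `b_i` in the augmentation ideal, and `(1 - b_i)⁻¹ = e^{a_i}`. -/
theorem Omega_b_mul (i : ZMod n) (h : IsSigma f F) :
    IsSigma (Omega (b n i) * f) (C (ex (a n i)) * (Omega (b n i) * F)) := by
  rw [isSigma_iff] at h ⊢
  exact (h.mul_left _).of_recurrence (b_mem_augIdeal n i) (one_sub_b_mul_ex n i)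
    (sliceSum_Omega_mul _ f)

/-- Division by `Ω(c|y)`: the recurrence is solved for the partial sums of `f`, so `c` need not be
topologically nilpotent. -/
theorem of_Omega_mul {c : RT n} (h : IsSigma (Omega c * f) F) :
    IsSigma f (invOfUnit (Omega c) 1 * (F - C c * F)) := by
  rw [isSigma_iff] at h ⊢
  have h1 := ((h.shift.sub (h.mul_left (C c))).mul_left (invOfUnit (Omega c) 1))
  refine AdicLim.of_shift ?_
  convert h1 using 2 with J
  rw [sliceSum_Omega_mul, add_sub_cancel_right, ← mul_assoc, mul_comm (invOfUnit _ _),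
    Omega_mul_invOfUnit, one_mul]

end IsSigma

theorem refl_of_ne_zero {n : ℕ} {i : ZMod n} (hi : i ≠ 0) (f : PS n) :
    refl n i f = MvPowerSeries.map (reflRT n i) f := if_neg hi

theorem refl_zero_eq (n : ℕ) (f : PS n) :
    refl n 0 f =
      Omega (b n 1) * invOfUnit (Omega (b n 0)) 1 * MvPowerSeries.map (reflRT n 0) f := if_pos rfl

theorem Omega_mul_refl_zero (n : ℕ) (f : PS n) :
    Omega (b n 0) * refl n 0 f = Omega (b n 1) * MvPowerSeries.map (reflRT n 0) f := by
  rw [refl_zero_eq]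
  linear_combination (Omega (b n 1) * MvPowerSeries.map (reflRT n 0) f) *
    Omega_mul_invOfUnit (b n 0)

theorem refl_C_mul (n : ℕ) (i : ZMod n) (v : CharLattice n) (f : PS n) :
    refl n i (C (ex v) * f) = C (ex (reflChar n i v)) * refl n i f := by
  by_cases hi : i = 0
  · subst hi
    rw [refl_zero_eq, refl_zero_eq, map_mul, map_C, reflRT_ex]
    ring
  · rw [refl_of_ne_zero hi, refl_of_ne_zero hi, map_mul, map_C, reflRT_ex]

theorem IsSigma.refl_of_ne_zero {n : ℕ} {i : ZMod n} (hi : i ≠ 0) {f F : PS n} (h : IsSigma f F) :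
    IsSigma (refl n i f) (refl n i F) := by
  rw [DoubleKSchur.refl_of_ne_zero hi, DoubleKSchur.refl_of_ne_zero hi]
  exact h.map_reflRT i

/-- `σ` multiplies the ratio `Ω(b_1)/Ω(b_n)` by `e^{a_1} (1 - b_n) = e^{a_1 - a_n} = e^{-α_0}`. -/
theorem IsSigma.refl_zero {n : ℕ} {f F : PS n} (h : IsSigma f F) :
    IsSigma (refl n 0 f) (C (ex (-simpleRoot n 0)) * refl n 0 F) := by
  have h2 := (h.map_reflRT 0).Omega_b_mul 1
  rw [← Omega_mul_refl_zero] at h2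
  have h3 := h2.of_Omega_mul
  convert h3 using 1
  have h4 : ex (-simpleRoot n 0) = ex (a n 1) * (1 - b n 0) := by
    rw [b, sub_sub_cancel, ← ex_add, simpleRoot, zero_add, neg_sub, sub_eq_add_neg]
  rw [refl_zero_eq, h4, map_mul, map_sub, map_one]
  ring

/-- The operator on the side of `σ f` that corresponds to `T_i` on the side of `f`. -/
noncomputable def sigmaT (n : ℕ) (i : ZMod n) (f : PS n) : PS n :=
  if i = 0 then C (ex (-simpleRoot n 0)) * D n 0 f else T n i f

theorem C_mul_D (n : ℕ) (i : ZMod n) (f : PS n) :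
    C (1 - ex (simpleRoot n i)) * D n i f = refl n i f - C (ex (simpleRoot n i)) * f := by
  rw [D, mul_add, T_spec, map_sub, map_one]
  ring

/-- For `i = 0` the numerator `s_0 - 1` turns into `e^{-α_0} s_0 - 1 = e^{-α_0} (s_0 - e^{α_0})`,
which is the numerator of `e^{-α_0} D_0`. -/
theorem IsSigma.T {n : ℕ} (hn : 2 ≤ n) (i : ZMod n) {f F : PS n} (h : IsSigma f F) :
    IsSigma (DoubleKSchur.T n i f) (sigmaT n i F) := by
  have : NeZero n := ⟨by omega⟩
  refine IsSigma.of_C_mul (one_sub_ex_simpleRoot_ne_zero n hn i) ?_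
  rw [T_spec]
  by_cases hi : i = 0
  · subst hi
    convert h.refl_zero.sub h using 1
    have h1 := C_mul_D n 0 F
    have h2 : C (σ := ℕ) (ex (simpleRoot n 0)) * C (ex (-simpleRoot n 0)) = 1 := by
      rw [← map_mul, ex_mul_ex_neg, map_one]
    rw [sigmaT, if_pos rfl]
    linear_combination C (ex (-simpleRoot n 0)) * h1 - F * h2
  · rw [sigmaT, if_neg hi, T_spec]
    exact (h.refl_of_ne_zero hi).sub h

theorem IsSigma.foldr_T {n : ℕ} (hn : 2 ≤ n) (w : List (ZMod n)) :
    IsSigma (w.foldr (DoubleKSchur.T n) 1) (w.foldr (sigmaT n) 1) := by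
  induction w with
  | nil => exact IsSigma.one
  | cons i w ih => exact ih.T hn i

theorem isSigma_foldr_iff {n : ℕ} (hn : 2 ≤ n) (w : List (ZMod n)) (F : PS n) :
    IsSigma (w.foldr (T n) 1) F ↔ F = w.foldr (sigmaT n) 1 := by
  have : NeZero n := ⟨by omega⟩
  exact ⟨fun h => h.unique (IsSigma.foldr_T hn w), fun h => h ▸ IsSigma.foldr_T hn w⟩

/-! ### Moving exponentials through the operators -/

/-- The action of `s_i` on characters of level one, which differs from the one on characters of
level zero only for `i = 0`. -/
def levelOneRefl (n : ℕ) (i : ZMod n) (v : CharLattice n) : CharLattice n :=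
  if i = 0 then reflChar n 0 v - simpleRoot n 0 else reflChar n i v

/-- If `i ≠ 0`, the factor `e^{v - α_i}` comes out of `s_i(e^v f) - e^v f` and leaves `s_i f -
e^{α_i} f`. If `i = 0`, the hypothesis says `s_θ v = v`, so `e^v` passes through `D_0`, and `-α_0`
is supplied by `sigmaT`. -/
theorem sigmaT_C_mul {n : ℕ} (hn : 2 ≤ n) (i : ZMod n) {v : CharLattice n} (f : PS n)
    (h : levelOneRefl n i v = v - simpleRoot n i) :
    sigmaT n i (C (ex v) * f) = C (ex (v - simpleRoot n i)) * D n i f := by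
  have h1 : C (σ := ℕ) (ex v) = C (ex (v - simpleRoot n i)) * C (ex (simpleRoot n i)) := by
    rw [← map_mul, ← ex_add, sub_add_cancel]
  have hD := C_mul_D n i f
  by_cases hi : i = 0
  · subst hi
    rw [levelOneRefl, if_pos rfl, sub_left_inj] at h
    have hDv : D n 0 (C (ex v) * f) = C (ex v) * D n 0 f := by
      have hT : T n 0 (C (ex v) * f) = C (ex v) * T n 0 f := by
        refine T_unique n hn _ _ _ ?_
        rw [refl_C_mul, h]
        linear_combination C (ex v) * T_spec n 0 f
      rw [D, D, hT, mul_add]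
    rw [sigmaT, if_pos rfl, hDv, ← mul_assoc, ← map_mul, ← ex_add, neg_add_eq_sub]
  · rw [levelOneRefl, if_neg hi] at h
    rw [sigmaT, if_neg hi]
    refine T_unique n hn _ _ _ ?_
    rw [refl_C_mul, h]
    linear_combination C (ex (v - simpleRoot n i)) * hD + f * h1

/-! ### The weights along the reduced word of a `k`-small partition -/

theorem reflChar_mk (n : ℕ) (i : ZMod n) (v : ZMod n → ℤ) :
    reflChar n i (QuotientAddGroup.mk v) =
      (QuotientAddGroup.mk v : CharLattice n) + (v (i + 1) - v i) • simpleRoot n i := by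
  change QuotientAddGroup.mk _ = QuotientAddGroup.mk
    (v + (v (i + 1) - v i) • (Pi.single i 1 - Pi.single (i + 1) 1))
  congr 1
  funext j
  by_cases h : i = i + 1
  · simp [← h]
  · by_cases h1 : j = i
    · subst h1
      simp [h]
    · by_cases h2 : j = i + 1
      · subst h2
        simp [Ne.symm h]
      · simp [Equiv.swap_apply_of_ne_of_ne h1 h2, h1, h2]

/-- Smallness keeps the relevant contents less than `n` apart, so residues can be compared as
integers. -/
theorem intCast_inj_of_lt {n : ℕ} {x y : ℤ} (h₁ : x - y < n) (h₂ : y - x < n) :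
    (x : ZMod n) = y ↔ x = y := by
  refine ⟨fun h => ?_, fun h => h ▸ rfl⟩
  have h3 := (ZMod.intCast_eq_intCast_iff_dvd_sub x y n).1 h
  have := Int.eq_zero_of_abs_lt_dvd h3 (abs_lt.2 ⟨by omega, by omega⟩)
  omega

theorem single_intCast_apply {n : ℕ} {x y : ℤ} (h₁ : x - y < n) (h₂ : y - x < n) :
    (Pi.single (x : ZMod n) 1 : ZMod n → ℤ) y = if y = x then 1 else 0 := by
  rw [Pi.single_apply]
  exact if_congr (intCast_inj_of_lt h₂ h₁) rfl rfl

theorem res_eq_intCast (n i j : ℕ) : res n i j = ((j - i : ℤ) : ZMod n) := by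
  simp [res]

theorem res_succ (n i j : ℕ) : res n i (j + 1) = res n i j + 1 := by
  simp [res]
  ring

/-- The sum of the `-α_r` over the residues `r` of the boxes in the first `i` rows of `lam` and in
the first `j` boxes of row `i`. -/
noncomputable def partialWeight (n : ℕ) (lam : YoungDiagram) (i j : ℕ) : CharLattice n :=
  ∑ p ∈ Finset.range i, (a n (res n p (lam.rowLen p)) - a n (res n p 0)) +
    (a n (res n i j) - a n (res n i 0))

theorem partialWeight_succ_right (n : ℕ) (lam : YoungDiagram) (i j : ℕ) :
    partialWeight n lam i (j + 1) = partialWeight n lam i j - simpleRoot n (res n i j) := by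
  rw [partialWeight, partialWeight, simpleRoot, res_succ]
  abel

theorem partialWeight_succ_left (n : ℕ) (lam : YoungDiagram) (i : ℕ) :
    partialWeight n lam (i + 1) 0 = partialWeight n lam i (lam.rowLen i) := by
  rw [partialWeight, partialWeight, Finset.sum_range_succ, sub_self, add_zero]

/-- The first boxes of rows `0, …, i` have contents `0, -1, …, -i`. In the window `-i ≤ x < n - i`
nothing wraps around, so `x` is hit exactly when `x ≤ 0`. -/
theorem sum_single_res_zero {n i : ℕ} {x : ℤ} (hx : -i ≤ x) (hi : i < n) (hxn : x + i < n) :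
    (∑ p ∈ Finset.range (i + 1), (Pi.single (res n p 0) 1 : ZMod n → ℤ) x) =
      if x ≤ 0 then 1 else 0 := by
  have h : ∀ p ∈ Finset.range (i + 1), (Pi.single (res n p 0) 1 : ZMod n → ℤ) x =
      if x = -p then 1 else 0 := by
    intro p hp
    rw [Finset.mem_range] at hp
    rw [res_eq_intCast, single_intCast_apply (by push_cast; omega) (by push_cast; omega)]
    simp
  rw [Finset.sum_congr rfl h]
  split_ifs with h0
  · obtain ⟨q, hq⟩ := Int.eq_ofNat_of_zero_le (show 0 ≤ -x by omega)
    rw [Finset.sum_eq_single_of_mem q (Finset.mem_range.2 (by omega)), if_pos (by omega)]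
    intro p _ hp
    rw [if_neg (by omega)]
  · exact Finset.sum_eq_zero fun p _ => if_neg (by omega)

/-- With `r` the residue of box `(i, j)`, the coordinates of the weight at `r` and `r + 1` are `1 -
[j ≤ i]` and `-[j < i]`. Their difference is `1` off the diagonal and `0` on it; smallness makes the
diagonal boxes exactly those of residue `0`. -/
theorem levelOneRefl_partialWeight {n : ℕ} (hn : 2 ≤ n) {lam : YoungDiagram} (h : IsKSmall n lam)
    {i j : ℕ} (hi : i < lam.colLen 0) (hj : j < lam.rowLen i) :
    levelOneRefl n (res n i j) (partialWeight n lam i j) =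
      partialWeight n lam i j - simpleRoot n (res n i j) := by
  have hsmall := h.2
  have hanti := lam.rowLen_anti
  have hi0 := hanti 0 i (Nat.zero_le i)
  -- A lift of the weight to `ℤⁿ`: ends of the completed rows, plus the current position, minus the
  -- starts of the rows.
  set V : ZMod n → ℤ := ∑ p ∈ Finset.range i, Pi.single (res n p (lam.rowLen p)) 1 +
    Pi.single (res n i j) 1 - ∑ p ∈ Finset.range (i + 1), Pi.single (res n p 0) 1 with hV
  have hW : partialWeight n lam i j = QuotientAddGroup.mk V := by
    change _ = QuotientAddGroup.mk' _ V
    rw [hV, map_sub, map_add, map_sum, map_sum, Finset.sum_range_succ _ i, partialWeight,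
      Finset.sum_sub_distrib]
    change _ = ∑ p ∈ Finset.range i, a n (res n p (lam.rowLen p)) + a n (res n i j) -
      (∑ p ∈ Finset.range i, a n (res n p 0) + a n (res n i 0))
    abel
  -- For `p < i` the content `λ_p - p` is at least `j - i + 2`, and it exceeds `x` by at most `λ_1 +
  -- i < n` (with `λ_1` the first part), so no earlier row end has the residue of `x`.
  have hfar : ∀ x : ℤ, j - i ≤ x → x ≤ j - i + 1 →
      ∑ p ∈ Finset.range i, (Pi.single (res n p (lam.rowLen p)) 1 : ZMod n → ℤ) x = 0 := by
    intro x hx hx'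
    refine Finset.sum_eq_zero fun p hp => ?_
    rw [Finset.mem_range] at hp
    have h1 := hanti p i hp.le
    have h2 := hanti 0 p (Nat.zero_le p)
    rw [res_eq_intCast, single_intCast_apply (by omega) (by omega), if_neg (by omega)]
  have hV0 : V (res n i j) = 1 - if (j - i : ℤ) ≤ 0 then 1 else 0 := by
    rw [hV, Pi.sub_apply, Pi.add_apply, Finset.sum_apply, Finset.sum_apply, Pi.single_eq_same,
      res_eq_intCast, hfar _ le_rfl (by omega),
      sum_single_res_zero (by omega) (by omega) (by omega), zero_add]
  have hV1 : V (res n i j + 1) = - if (j - i + 1 : ℤ) ≤ 0 then 1 else 0 := by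
    have h1 : res n i j + 1 = ((j - i + 1 : ℤ) : ZMod n) := by simp [res_eq_intCast]
    rw [hV, Pi.sub_apply, Pi.add_apply, Finset.sum_apply, Finset.sum_apply, h1,
      hfar _ (by omega) (by omega), sum_single_res_zero (by omega) (by omega) (by omega),
      res_eq_intCast, single_intCast_apply (by omega) (by omega), if_neg (by omega), zero_add, zero_sub]
  have hr : res n i j = 0 ↔ i = j := by
    rw [res_eq_intCast, ← Int.cast_zero, intCast_inj_of_lt (by omega) (by omega)]
    omega
  rw [levelOneRefl, hW]
  split_ifs with h0
  · have hij := hr.1 h0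
    have h1 : V (res n i j + 1) - V (res n i j) = 0 := by
      rw [hV0, hV1]
      split_ifs <;> omega
    rw [← h0, reflChar_mk, h1, zero_smul, add_zero]
  · have hij := mt hr.2 h0
    have h1 : V (res n i j + 1) - V (res n i j) = -1 := by
      rw [hV0, hV1]
      split_ifs <;> omega
    rw [reflChar_mk, h1, neg_one_smul, sub_eq_add_neg]

theorem foldl_row_sigmaT {n : ℕ} (hn : 2 ≤ n) {lam : YoungDiagram} (h : IsKSmall n lam)
    {i : ℕ} (hi : i < lam.colLen 0) (F : PS n) (j : ℕ) (hj : j ≤ lam.rowLen i) :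
    ((List.range j).map fun j => res n i j).foldl (fun f r => sigmaT n r f)
        (C (ex (partialWeight n lam i 0)) * F) =
      C (ex (partialWeight n lam i j)) *
        ((List.range j).map fun j => res n i j).foldl (fun f r => D n r f) F := by
  induction j with
  | zero => rfl
  | succ j ih =>
    rw [List.range_succ, List.map_append, List.foldl_append, List.foldl_append, ih (by omega)]
    simp only [List.map_cons, List.map_nil, List.foldl_cons, List.foldl_nil]
    rw [sigmaT_C_mul hn _ _ (levelOneRefl_partialWeight hn h hi (by omega)),
      partialWeight_succ_right]

theorem foldl_rows_sigmaT {n : ℕ} (hn : 2 ≤ n) {lam : YoungDiagram} (h : IsKSmall n lam)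
    (i : ℕ) (hi : i ≤ lam.colLen 0) :
    ((List.range i).flatMap fun i => (List.range (lam.rowLen i)).map fun j => res n i j).foldl
        (fun f r => sigmaT n r f) 1 =
      C (ex (partialWeight n lam i 0)) *
        ((List.range i).flatMap fun i => (List.range (lam.rowLen i)).map fun j => res n i j).foldl
          (fun f r => D n r f) 1 := by
  induction i with
  | zero => simp [partialWeight, ex_zero]
  | succ i ih =>
    rw [List.range_succ, List.flatMap_append, List.foldl_append, List.foldl_append,
      ih (by omega), List.flatMap_singleton, foldl_row_sigmaT hn h (by omega) _ _ le_rfl,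
      partialWeight_succ_left]

/-! ### The total weight as a sum over the diagonal -/

theorem partialWeight_colLen (n : ℕ) (lam : YoungDiagram) :
    partialWeight n lam (lam.colLen 0) 0 =
      ∑ c ∈ lam.cells, (a n (res n c.1 c.2 + 1) - a n (res n c.1 c.2)) := by
  rw [Finset.sum_finset_product lam.cells (Finset.range (lam.colLen 0))
    (fun p => Finset.range (lam.rowLen p)), partialWeight, sub_self, add_zero]
  · refine Finset.sum_congr rfl fun p _ => ?_
    simp only [← res_succ]
    exact (Finset.sum_range_sub (fun j => a n (res n p j)) _).symm
  · rintro ⟨p, j⟩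
    rw [YoungDiagram.mem_cells, Finset.mem_range, Finset.mem_range,
      ← YoungDiagram.mem_iff_lt_colLen, ← YoungDiagram.mem_iff_lt_rowLen]
    exact ⟨fun h => ⟨lam.up_left_mem le_rfl (Nat.zero_le _) h, h⟩, fun h => h.2⟩

/-- The diagram is cut into the hooks of its diagonal boxes. Along the arm, diagonal box included,
the sum telescopes to `a_{r+1} - a_0`; along the leg it telescopes to `a_0 - a_b`. -/
theorem sum_cells_eq_sum_diag (n : ℕ) (lam : YoungDiagram) :
    ∑ c ∈ lam.cells, (a n (res n c.1 c.2 + 1) - a n (res n c.1 c.2)) =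
      ∑ x ∈ lam.cells.filter (fun x => x.1 = x.2),
        (a n (res n x.1 (lam.rowLen x.1 - 1) + 1) - a n (res n (lam.colLen x.2 - 1) x.2)) := by
  set S := (Finset.range (lam.colLen 0)).filter fun p => (p, p) ∈ lam with hS
  have hmem : ∀ p, p ∈ S ↔ (p, p) ∈ lam := by
    intro p
    rw [hS, Finset.mem_filter, Finset.mem_range, ← YoungDiagram.mem_iff_lt_colLen]
    exact ⟨fun h => h.2, fun h => ⟨lam.up_left_mem le_rfl (Nat.zero_le _) h, h⟩⟩
  rw [← Finset.sum_filter_add_sum_filter_not lam.cells (fun c => c.1 ≤ c.2),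
    Finset.sum_finset_product (lam.cells.filter fun c => c.1 ≤ c.2) S
      (fun p => Finset.Ico p (lam.rowLen p)),
    Finset.sum_finset_product_right (lam.cells.filter fun c => ¬ c.1 ≤ c.2) S
      (fun q => Finset.Ico (q + 1) (lam.colLen q)),
    Finset.sum_finset_product (lam.cells.filter fun c => c.1 = c.2) S (fun p => {p}),
    ← Finset.sum_add_distrib]
  · refine Finset.sum_congr rfl fun p hp => ?_
    have hp' := (hmem p).1 hp
    have hrow := YoungDiagram.mem_iff_lt_rowLen.1 hp'
    have hcol := YoungDiagram.mem_iff_lt_colLen.1 hp'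
    have h1 : ∑ j ∈ Finset.Ico p (lam.rowLen p), (a n (res n p j + 1) - a n (res n p j)) =
        a n (res n p (lam.rowLen p)) - a n 0 := by
      simp only [← res_succ]
      rw [Finset.sum_Ico_sub (fun j => a n (res n p j)) hrow.le]
      simp [res]
    -- Here `m` is the leg length; for `m = 0` the diagonal box is itself the bottom of its column.
    have h2 : ∀ m, ∑ i ∈ Finset.Ico (p + 1) (p + 1 + m), (a n (res n i p + 1) - a n (res n i p)) =
        a n 0 - a n (res n (p + m) p) := by
      intro m
      induction m with
      | zero => simp [res]
      | succ m ih =>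
        rw [← add_assoc, Finset.sum_Ico_succ_top (by omega), ih]
        have h3 : res n (p + 1 + m) p + 1 = res n (p + m) p := by
          simp [res]
          ring
        rw [h3, add_right_comm p 1 m]
        abel
    obtain ⟨m, hm⟩ := Nat.exists_eq_add_of_lt hcol
    have h4 := h2 m
    rw [add_right_comm p 1 m, ← hm] at h4
    rw [Finset.sum_singleton, h1, h4, ← res_succ, Nat.sub_add_cancel (show 1 ≤ lam.rowLen p by omega), hm,
      Nat.add_sub_cancel]
    abel
  · rintro ⟨i, j⟩
    simp only [Finset.mem_filter, YoungDiagram.mem_cells, Finset.mem_singleton, hmem]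
    exact ⟨fun ⟨h, h'⟩ => by subst h'; exact ⟨h, rfl⟩, fun ⟨h, h'⟩ => by subst h'; exact ⟨h, rfl⟩⟩
  · rintro ⟨i, j⟩
    simp only [Finset.mem_filter, YoungDiagram.mem_cells, Finset.mem_Ico, hmem, not_le,
      ← YoungDiagram.mem_iff_lt_colLen]
    exact ⟨fun ⟨h, h'⟩ => ⟨lam.up_left_mem h'.le le_rfl h, h', h⟩, fun ⟨_, h', h⟩ => ⟨h, h'⟩⟩
  · rintro ⟨i, j⟩
    simp only [Finset.mem_filter, YoungDiagram.mem_cells, Finset.mem_Ico, hmem,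
      ← YoungDiagram.mem_iff_lt_rowLen]
    exact ⟨fun ⟨h, h'⟩ => ⟨lam.up_left_mem le_rfl h' h, h', h⟩, fun ⟨_, h', h⟩ => ⟨h, h'⟩⟩

theorem ex_sum {n : ℕ} {ι : Type*} (s : Finset ι) (v : ι → CharLattice n) :
    ex (∑ x ∈ s, v x) = ∏ x ∈ s, ex (v x) := by
  induction s using Finset.cons_induction with
  | empty => exact ex_zero
  | cons x s hx ih => rw [Finset.sum_cons, Finset.prod_cons, ex_add, ih]

theorem foldr_sigmaT_redWord {n : ℕ} (hn : 2 ≤ n) {lam : YoungDiagram} (h : IsKSmall n lam) :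
    (redWord n lam).foldr (sigmaT n) 1 = C (diagMonomial n lam) * gTilde n lam := by
  -- The word is the reversed row reading, so the operators act box by box along the rows, from the
  -- top row down.
  rw [gTilde, redWord, List.foldr_reverse, List.foldr_reverse, foldl_rows_sigmaT hn h _ le_rfl,
    partialWeight_colLen, sum_cells_eq_sum_diag, ex_sum, diagMonomial]

/-! ### The partition `(2, 1)` for `n = 3` -/

theorem redWord_of_rowLens_two {mu : YoungDiagram} (h : mu.rowLens = [2]) :
    redWord 3 mu = [1, 0] := by
  have hc : mu.colLen 0 = 1 := by rw [← YoungDiagram.length_rowLens, h]; rfl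
  have h0 : mu.rowLen 0 = 2 := by simpa [YoungDiagram.rowLens, hc] using h
  simp [redWord, hc, h0, List.range_succ, res]

theorem redWord_of_rowLens_two_one {lam : YoungDiagram} (h : lam.rowLens = [2, 1]) :
    redWord 3 lam = [2, 1, 0] := by
  have hc : lam.colLen 0 = 2 := by rw [← YoungDiagram.length_rowLens, h]; rfl
  have hr : lam.rowLen 0 = 2 ∧ lam.rowLen 1 = 1 := by
    simpa [YoungDiagram.rowLens, hc, List.range_succ] using h
  simp [redWord, hc, hr.1, hr.2, List.range_succ, res]
  decide

/-- After the first row the weight is `v = a_2 - a_3 = α_2`, so `s_2 v = v - 2 α_2`. Then `e^{-α}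
s_2 f - e^α f = e^{-α} (s_2 f - e^α f) + (1 - e^α) f` with `α = α_2`, and the last summand
contributes the extra `f`. -/
theorem foldr_sigmaT_two_one :
    ([2, 1, 0] : List (ZMod 3)).foldr (sigmaT 3) 1 =
      ([1, 0] : List (ZMod 3)).foldr (D 3) 1 +
        C (ex (a 3 3 - a 3 2)) * ([2, 1, 0] : List (ZMod 3)).foldr (D 3) 1 := by
  have hn : 2 ≤ 3 := by norm_num
  simp only [List.foldr_cons, List.foldr_nil]
  have e0 : sigmaT 3 0 1 = C (ex (a 3 1 - a 3 0)) * D 3 0 1 := by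
    rw [sigmaT, if_pos rfl, simpleRoot, neg_sub, zero_add]
  have e1 : sigmaT 3 1 (sigmaT 3 0 1) = C (ex (a 3 2 - a 3 0)) * D 3 1 (D 3 0 1) := by
    have hv : a 3 1 - a 3 0 - simpleRoot 3 1 = a 3 2 - a 3 0 := by
      rw [simpleRoot, show (1 + 1 : ZMod 3) = 2 from rfl]
      abel
    rw [e0, sigmaT_C_mul hn, hv]
    rw [levelOneRefl, if_neg (by decide), hv, map_sub, reflChar_a, reflChar_a]
    rfl
  rw [e1]
  set f := D 3 1 (D 3 0 1)
  have h30 : (3 : ZMod 3) = 0 := rfl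
  have hα : simpleRoot 3 2 = a 3 2 - a 3 0 := rfl
  have hrefl : reflChar 3 2 (a 3 2 - a 3 0) = a 3 0 - a 3 2 := by
    rw [map_sub, reflChar_a, reflChar_a]
    rfl
  rw [sigmaT, if_neg (by decide), h30]
  refine T_unique 3 hn _ _ _ ?_
  have hD := C_mul_D 3 2 f
  rw [refl_C_mul, hrefl]
  rw [hα] at hD ⊢
  have h2 : C (σ := ℕ) (ex (a 3 0 - a 3 2)) * C (ex (a 3 2 - a 3 0)) = 1 := by
    rw [← map_mul, ← ex_add, ← neg_sub (a 3 2), neg_add_cancel, ex_zero, map_one]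
  rw [map_sub, map_one] at hD ⊢
  linear_combination C (ex (a 3 0 - a 3 2)) * hD - f * h2

/-! ### Coefficients of degree at most one -/

theorem coeff_zero_Omega_mul {n : ℕ} (c : RT n) (f : PS n) : coeff 0 (Omega c * f) = coeff 0 f := by
  have h : coeff 0 (Omega c) = 1 := by
    change c ^ (0 : ℕ →₀ ℕ).degree = 1
    simp
  rw [coeff_zero_eq_constantCoeff_apply] at h ⊢
  rw [map_mul, h, one_mul, coeff_zero_eq_constantCoeff_apply]

theorem coeff_consExp_one_Omega_mul {n : ℕ} (c : RT n) (f : PS n) :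
    coeff (consExp 1 0) (Omega c * f) = coeff (consExp 1 0) f + c * coeff 0 f := by
  have h := congrArg (coeff 0) (slice_succ_Omega_mul 0 c f)
  rw [slice_zero_Omega_mul, map_add, coeff_C_mul, coeff_zero_Omega_mul, coeff_zero_Omega_mul] at h
  simpa only [coeff_slice, zero_add, show consExp 0 0 = 0 by simp [consExp]] using h

theorem coeff_zero_refl (n : ℕ) (i : ZMod n) (f : PS n) :
    coeff 0 (refl n i f) = reflRT n i (coeff 0 f) := by
  by_cases hi : i = 0
  · subst hi
    rw [← coeff_zero_Omega_mul (b n 0), Omega_mul_refl_zero, coeff_zero_Omega_mul, coeff_map]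
  · rw [refl_of_ne_zero hi, coeff_map]

/-- `T_i` vanishes on a coefficient left unchanged by `s_i`. -/
theorem coeff_D_of_coeff_refl {n : ℕ} (hn : 2 ≤ n) {i : ZMod n} {f : PS n} {m : ℕ →₀ ℕ}
    (h : coeff m (refl n i f) = coeff m f) : coeff m (D n i f) = coeff m f := by
  have : NeZero n := ⟨by omega⟩
  refine mul_left_cancel₀ (one_sub_ex_simpleRoot_ne_zero n hn i) ?_
  rw [← coeff_C_mul, C_mul_D, map_sub, coeff_C_mul, h]
  ring

theorem coeff_zero_foldr_D {n : ℕ} (hn : 2 ≤ n) (w : List (ZMod n)) :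
    coeff 0 (w.foldr (D n) 1) = 1 := by
  induction w with
  | nil => simp
  | cons i w ih =>
    rw [List.foldr_cons, coeff_D_of_coeff_refl hn, ih]
    rw [coeff_zero_refl, ih, map_one]

theorem coeff_consExp_one_D_zero {n : ℕ} (hn : 2 ≤ n) :
    coeff (consExp 1 0) (D n 0 1) = ex (-a n 0) := by
  have : NeZero n := ⟨by omega⟩
  refine mul_left_cancel₀ (one_sub_ex_simpleRoot_ne_zero n hn 0) ?_
  have h1 : coeff (consExp 1 0) (1 : PS n) = 0 := by
    classical
    rw [coeff_one, if_neg]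
    intro h
    simpa [consExp_zero_apply] using DFunLike.congr_fun h 0
  have h2 := congrArg (coeff (consExp 1 0)) (Omega_mul_refl_zero n 1)
  rw [map_one, coeff_consExp_one_Omega_mul, coeff_consExp_one_Omega_mul, coeff_zero_refl, h1,
    coeff_zero_one, map_one, mul_one, mul_one, zero_add] at h2
  -- Hence `b_1 - b_n = e^{-a_n} - e^{-a_1} = (1 - e^{α_0}) e^{-a_n}`.
  have h3 : ex (-a n 1) = ex (simpleRoot n 0) * ex (-a n 0) := by
    rw [← ex_add, simpleRoot, zero_add]
    congr 1
    abel
  rw [← coeff_C_mul, C_mul_D, map_sub, coeff_C_mul, h1, eq_sub_of_add_eq h2, b, b, h3]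
  ring

/-- With `f = D_1 D_0 (1)`, the equality `D_2 f = f` would make `f` invariant under `s_2`. The
coefficient of `y_0` in `f` is `e^{-a_0}`, which `s_2` moves to `e^{-a_2}`. -/
theorem foldr_D_two_one_ne :
    ([2, 1, 0] : List (ZMod 3)).foldr (D 3) 1 ≠ ([1, 0] : List (ZMod 3)).foldr (D 3) 1 := by
  have hn : 2 ≤ 3 := by norm_num
  simp only [List.foldr_cons, List.foldr_nil]
  intro h
  have h1 : coeff (consExp 1 0) (D 3 1 (D 3 0 1)) = ex (-a 3 0) := by
    rw [coeff_D_of_coeff_refl hn, coeff_consExp_one_D_zero hn]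
    rw [refl_of_ne_zero (by decide), coeff_map, coeff_consExp_one_D_zero hn, reflRT_ex, map_neg,
      reflChar_a]
    rfl
  have h2 := C_mul_D 3 2 (D 3 1 (D 3 0 1))
  rw [h] at h2
  have h3 := congrArg (coeff (consExp 1 0)) h2
  rw [coeff_C_mul, map_sub, coeff_C_mul, refl_of_ne_zero (by decide), coeff_map, h1, reflRT_ex,
    map_neg, reflChar_a] at h3
  have h4 : ex (-a 3 2) = ex (-a 3 0) := by
    have h5 : Equiv.swap (2 : ZMod 3) (2 + 1) 0 = 2 := rfl
    rw [h5] at h3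
    linear_combination -h3
  have h6 := a_injective 3 le_rfl (neg_injective (ex_injective 3 h4))
  exact absurd h6 (by decide)

end DoubleKSchur

theorem mainTheorem10 :
    (∀ n : ℕ, 2 ≤ n → ∀ lam : YoungDiagram, DoubleKSchur.IsKSmall n lam →
      ∀ F : DoubleKSchur.PS n,
        DoubleKSchur.IsSigma (DoubleKSchur.g n lam) F ↔
          F = MvPowerSeries.C (DoubleKSchur.diagMonomial n lam) * DoubleKSchur.gTilde n lam) ∧
    (∀ lam mu : YoungDiagram, lam.rowLens = [2, 1] → mu.rowLens = [2] →
      (DoubleKSchur.IsKBounded 3 lam ∧ ¬ DoubleKSchur.IsKSmall 3 lam) ∧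
      (∀ F : DoubleKSchur.PS 3,
        DoubleKSchur.IsSigma (DoubleKSchur.g 3 lam) F ↔
          F = DoubleKSchur.gTilde 3 mu +
            MvPowerSeries.C (DoubleKSchur.ex (DoubleKSchur.a 3 3 - DoubleKSchur.a 3 2)) *
              DoubleKSchur.gTilde 3 lam) ∧
      (∀ c : DoubleKSchur.RT 3,
        ¬ DoubleKSchur.IsSigma (DoubleKSchur.g 3 lam)
          (MvPowerSeries.C c * DoubleKSchur.gTilde 3 lam))) := by
  refine ⟨fun n hn lam h F => ?_, fun lam mu hlam hmu => ?_⟩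
  · rw [DoubleKSchur.g, DoubleKSchur.isSigma_foldr_iff hn, DoubleKSchur.foldr_sigmaT_redWord hn h]
  have hn : 2 ≤ 3 := by norm_num
  have hc : lam.colLen 0 = 2 := by rw [← YoungDiagram.length_rowLens, hlam]; rfl
  have hr : lam.rowLen 0 = 2 ∧ lam.rowLen 1 = 1 := by
    simpa [YoungDiagram.rowLens, hc, List.range_succ] using hlam
  have key : ∀ F : DoubleKSchur.PS 3, DoubleKSchur.IsSigma (DoubleKSchur.g 3 lam) F ↔
      F = DoubleKSchur.gTilde 3 mu +
        MvPowerSeries.C (DoubleKSchur.ex (DoubleKSchur.a 3 3 - DoubleKSchur.a 3 2)) *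
          DoubleKSchur.gTilde 3 lam := by
    intro F
    rw [DoubleKSchur.g, DoubleKSchur.isSigma_foldr_iff hn, DoubleKSchur.gTilde,
      DoubleKSchur.gTilde, DoubleKSchur.redWord_of_rowLens_two hmu,
      DoubleKSchur.redWord_of_rowLens_two_one hlam, DoubleKSchur.foldr_sigmaT_two_one]
  refine ⟨⟨?_, ?_⟩, key, fun c hc' => ?_⟩
  · rw [DoubleKSchur.IsKBounded, hr.1]
  · rintro ⟨_, h⟩
    omega
  -- Both closed functions have constant coefficient `1`, so `c = 1 + e^{a_3 - a_2}`; substituting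
  -- back leaves the false equality of the two closed functions.
  · have h := (key _).1 hc'
    have h0 := congrArg (MvPowerSeries.coeff 0) h
    rw [map_add, MvPowerSeries.coeff_C_mul, MvPowerSeries.coeff_C_mul, DoubleKSchur.gTilde,
      DoubleKSchur.gTilde, DoubleKSchur.coeff_zero_foldr_D hn, DoubleKSchur.coeff_zero_foldr_D hn,
      mul_one, mul_one] at h0
    rw [h0, map_add, map_one, add_mul, one_mul, add_left_inj, DoubleKSchur.gTilde,
      DoubleKSchur.gTilde, DoubleKSchur.redWord_of_rowLens_two hmu,
      DoubleKSchur.redWord_of_rowLens_two_one hlam] at h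
    exact DoubleKSchur.foldr_D_two_one_ne h
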